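/- **Theorem (Main Result).** Let $\alpha_1,\dots,\alpha_n\in\mathbb R^n$ be a system of simple roots of a finite reflection group: they are linearly independent, the group $W\le O(n)$ generated by the reflections $s_i$ in the hyperplanes $\alpha_i^{\perp}$ is finite, and every vector normal to the mirror of a reflection in $W$ is a linear combination of the $\alpha_i$ with all coefficients $\ge 0$ or all $\le 0$. Put $S=\{s_1,\dots,s_n\}$; let $W^*=\{w\in W:\det w=1\}$ be the subgroup of rotations and, for $I\subseteq S$, let $W_I=\langle I\rangle$ and let $$C_I=\{x\in\mathbb R^n:\ \langle\alpha_i,x\rangle=0 \text{ if } s_i\in I,\ \ \langle\alpha_i,x\rangle>0 \text{ if } s_i\notin I\}.$$ For each $I\subseteq S$ fix a point $p_I\in C_I$. *Polypolyhedra.* A strut of orbit-type $(W,I,J)$ is an unordered pair $\{a,b\}$ of different points with $a\in Wp_I$, $b\in Wp_J$. The set it generates is $\{\{r(a),r(b)\}: r\in W^*\}$. The valency of a point in a set of struts is the number of struts of that set incident to it. A general polypolyhedron of orbit-type $(W,I,J)$ is a set generated by a strut of that orbit-type in which every endpoint has valency at least $2$; a strut is univalent if one of its two endpoints has valency $1$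 in the set that it generates. Let $P(W,I,J)$ be the number of general polypolyhedra of orbit-type $(W,I,J)$, where two are identified if an element of $W$ maps one onto the other, and let $U(W,I,J)$ be the number of $W$-orbits of univalent struts of orbit-type $(W,I,J)$. *Centralisers.* For $u\in W$ let $C_W(u)$ be the centraliser of $u$ in $W$. For a subgroup $H\le W$ let $\mathrm{Conj}_H(u)$ be the set of all elements of $H$ that are conjugate to $u$ in $W$, and when it is non-empty let $|C_H(u)|$ denote the number $|H|/|\mathrm{Conj}_H(u)|$. (For $H=W$ this is the order of the centraliser of $u$; for $u\in H$ it is the order of the centraliser of $u$ in $H$ if all $W$-conjugates of $u$ in $H$ are conjugate in $H$.) Let $\sqrt{W_I}=\{u\in W: u^2\in W_I\}$. 1. (Heteroorbital case) Let $I\ne J$, and let $u_i$ run through representatives of the conjugacy classes of $W$ that intersect both $W_I$ and $W_J$, one for each such class. Then $$P(W,I,J)=\sum_i\frac{|C_W(u_i)|}{|C_{W_I}(u_i)|\,|C_{W_J}(u_i)|}-U(W,I,J).$$ 2. (Homoorbital case) Let $I=J$, and let $u_i$ and $w_j$ run through representatives of the conjugacy classes of $W$ that intersect $W_I$ and $\sqrt{W_I}$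 respectively, one for each such class. Then $$P(W,I,I)=\frac12\left[\sum_i\frac{|C_W(u_i)|}{|C_{W_I}(u_i)|^2}+\sum_j\frac{|C_W(w_j^2)|}{|C_{W_I}(w_j^2)|\,|C_W(w_j)|}\right]-1-U(W,I,I).$$ -/

import Mathlib

namespace Polypolyhedra

open scoped RealInnerProductSpace

noncomputable section

/-- Euclidean space `ℝⁿ`. -/
abbrev E (n : ℕ) : Type := EuclideanSpace ℝ (Fin n)

/-- The orthogonal group `O(n)`: all linear isometries of `ℝⁿ`. -/
abbrev O (n : ℕ) : Type := E n ≃ₗᵢ[ℝ] E n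

/-- The reflection `s_β` in the hyperplane orthogonal to `β` (used only for `β ≠ 0`). -/
def refl {n : ℕ} (β : E n) : O n := (ℝ ∙ β)ᗮ.reflection

/-- The reflection group `W` generated by the reflections `s_i` in the vectors `α i`. -/
def W {n : ℕ} (α : Fin n → E n) : Subgroup (O n) :=
  Subgroup.closure (Set.range fun i => refl (α i))

/-- `α` is a system of simple roots of a finite reflection group on `ℝⁿ`: the vectors `α i` are
linearly independent, the group `W` they generate is finite, and every root of `W` (every normal
vector of a reflection belonging to `W`) is a linear combination of the `α i` whose coefficients
are all nonnegative or all nonpositive. The `s_i = refl (α i)` are then the simple reflections. -/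
structure IsSimpleSystem {n : ℕ} (α : Fin n → E n) : Prop where
  linearIndependent : LinearIndependent ℝ α
  finite : Finite (W α)
  root_sign : ∀ β : E n, β ≠ 0 → refl β ∈ W α →
    ∃ c : Fin n → ℝ, β = ∑ i, c i • α i ∧ ((∀ i, 0 ≤ c i) ∨ (∀ i, c i ≤ 0))

/-- The standard parabolic subgroup `W_I`, generated by the `s_i` with `i ∈ I`. -/
def parabolic {n : ℕ} (α : Fin n → E n) (I : Set (Fin n)) : Subgroup (W α) :=
  Subgroup.closure {s : W α | ∃ i ∈ I, (s : O n) = refl (α i)}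

/-- The facet `C_I`: on the hyperplane of `s_i` for `i ∈ I`, on its positive side for `i ∉ I`. -/
def facet {n : ℕ} (α : Fin n → E n) (I : Set (Fin n)) : Set (E n) :=
  {x | ∀ i, (i ∈ I → ⟪α i, x⟫ = 0) ∧ (i ∉ I → 0 < ⟪α i, x⟫)}

/-- `w` is a rotation, i.e. belongs to `W^*`. -/
def IsRotation {n : ℕ} {α : Fin n → E n} (w : W α) : Prop :=
  LinearMap.det ((w : O n).toLinearEquiv : E n →ₗ[ℝ] E n) = 1

/-- The action of `W` on unordered pairs of points (segments, given by their two endpoints). -/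
def move {n : ℕ} {α : Fin n → E n} (w : W α) (x : Sym2 (E n)) : Sym2 (E n) :=
  Sym2.map (w : O n) x

theorem move_one {n : ℕ} {α : Fin n → E n} (x : Sym2 (E n)) : move (1 : W α) x = x := by
  induction x with | _ a b => rfl

theorem move_mul {n : ℕ} {α : Fin n → E n} (v w : W α) (x : Sym2 (E n)) :
    move (v * w) x = move v (move w x) := by
  induction x with | _ a b => rfl

/-- The struts with one endpoint in the orbit `W a` and the other in the orbit `W b`: unordered
pairs of two different points. -/
def struts {n : ℕ} (α : Fin n → E n) (a b : E n) : Set (Sym2 (E n)) :=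
  {x | ¬ x.IsDiag ∧ ∃ v w : W α, x = s((v : O n) a, (w : O n) b)}

/-- The set of struts generated by the seed strut `x`: its images under the rotations in `W`. -/
def generated {n : ℕ} (α : Fin n → E n) (x : Sym2 (E n)) : Set (Sym2 (E n)) :=
  {y | ∃ r : W α, IsRotation r ∧ y = move r x}

/-- The valency of the point `v` in a set `Q` of struts: the number of struts incident to it. -/
def valency {n : ℕ} (Q : Set (Sym2 (E n))) (v : E n) : ℕ∞ :=
  {y | y ∈ Q ∧ v ∈ y}.encard

/-- General polypolyhedra with endpoints in the orbits `W a` and `W b`: sets of struts generated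
by a seed strut in which every endpoint is incident to at least two struts. -/
def IsPolypolyhedron {n : ℕ} (α : Fin n → E n) (a b : E n) (Q : Set (Sym2 (E n))) : Prop :=
  (∃ x ∈ struts α a b, Q = generated α x) ∧
    ∀ v : E n, (∃ y ∈ Q, v ∈ y) → 2 ≤ valency Q v

/-- The strut `x` is univalent: one of its endpoints has valency 1 in the set generated by `x`. -/
def IsUnivalent {n : ℕ} (α : Fin n → E n) (x : Sym2 (E n)) : Prop :=
  ∃ v ∈ x, valency (generated α x) v = 1

/-- Two polypolyhedra are equivalent if an element of `W` maps one onto the other. -/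
def polySetoid {n : ℕ} (α : Fin n → E n) (a b : E n) :
    Setoid {Q : Set (Sym2 (E n)) // IsPolypolyhedron α a b Q} where
  r Q Q' := ∃ w : W α, move w '' Q.1 = Q'.1
  iseqv :=
    { refl := fun Q => ⟨1, by simp [move_one]⟩
      symm := by
        rintro Q Q' ⟨w, h⟩
        refine ⟨w⁻¹, ?_⟩
        rw [← h, Set.image_image]
        simp [← move_mul, move_one]
      trans := by
        rintro Q Q' Q'' ⟨w, h⟩ ⟨v, h'⟩
        refine ⟨v * w, ?_⟩
        rw [← h', ← h, Set.image_image]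
        simp [move_mul] }

/-- Two univalent struts are equivalent if an element of `W` maps one to the other. -/
def univalentSetoid {n : ℕ} (α : Fin n → E n) (a b : E n) :
    Setoid {x : Sym2 (E n) // x ∈ struts α a b ∧ IsUnivalent α x} where
  r x y := ∃ w : W α, move w x.1 = y.1
  iseqv :=
    { refl := fun x => ⟨1, move_one _⟩
      symm := by
        rintro x y ⟨w, h⟩
        exact ⟨w⁻¹, by rw [← h, ← move_mul, inv_mul_cancel, move_one]⟩
      trans := by
        rintro x y z ⟨w, h⟩ ⟨v, h'⟩
        exact ⟨v * w, by rw [← h', ← h, move_mul]⟩ }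

/-- `P`: the number of general polypolyhedra with endpoints in `W a` and `W b`, up to `W`. -/
def numPoly {n : ℕ} (α : Fin n → E n) (a b : E n) : ℕ :=
  Nat.card (Quotient (polySetoid α a b))

/-- `U`: the number of univalent struts with endpoints in `W a` and `W b`, up to `W`. -/
def numUnivalent {n : ℕ} (α : Fin n → E n) (a b : E n) : ℕ :=
  Nat.card (Quotient (univalentSetoid α a b))

section Group

variable {G : Type*} [Group G]

/-- The order `|C_G(u)|` of the centraliser of `u` in the whole group. -/
def cent (u : G) : ℚ := Nat.card (Subgroup.centralizer ({u} : Set G))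

/-- `Conj_H(u)`: the elements of the subgroup `H` that are conjugate to `u` in `G`. -/
def conjIn (H : Subgroup G) (u : G) : Set G := {v | v ∈ H ∧ IsConj u v}

/-- `|C_H(u)|`, defined through the class equation `|H| = |Conj_H(u)| |C_H(u)|`. -/
def centIn (H : Subgroup G) (u : G) : ℚ := Nat.card H / (conjIn H u).ncard

/-- `√H`, the set of all `u` with `u² ∈ H`. -/
def sqrtSet (H : Subgroup G) : Set G := {u | u ^ 2 ∈ H}

/-- The union of the conjugacy classes of `G` that intersect `A`. -/
def classHull (A : Set G) : Set G := {u | ∃ a ∈ A, IsConj u a}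

/-- `R` consists of exactly one representative of each conjugacy class of `G` contained in `A`
(used for unions `A` of conjugacy classes). -/
def IsClassReps (R : Finset G) (A : Set G) : Prop :=
  (∀ u ∈ R, u ∈ A) ∧ ∀ a ∈ A, ∃! u, u ∈ R ∧ IsConj u a

end Group

end

end Polypolyhedra

/-! A strut is either univalent or generates a polypolyhedron, and two non-univalent struts generate
equivalent polypolyhedra exactly when they share a `W`-orbit. Hence P + U is the number of
`W`-orbits of struts (`numPoly_add_numUnivalent`), by Burnside the average over w of the number of
struts invariant under w.

Let f_I(w) count the points of W p_I fixed by w. If I ≠ J the two orbits are disjoint, so w cannot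
swap endpoints and the number is f_I(w) f_J(w). If I = J swaps do occur, and the number is (f_I(w)²
+ f_I(w²))/2 - f_I(w); the last term averages to 1 by transitivity.

The geometric input is that p_I has stabiliser W_I, which follows from deletion in words of simple
reflections (`IsSimpleSystem.word_fixes`). Double counting then gives f_I(u) = |C_W(u)| /
|C_{W_I}(u)| (`fixCount_eq`), and collecting the averages by classes, of size |W| / |C_W(u)|, yields
the formulas. -/

namespace Polypolyhedra

open scoped RealInnerProductSpace

/-! ### Simple reflections, deletion and stabilisers of points in facets -/

section Geometry

variable {n : ℕ} {α : Fin n → E n}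

theorem refl_apply (β x : E n) : refl β x = x - (2 * (⟪β, x⟫ / ‖β‖ ^ 2)) • β := by
  rw [refl, Submodule.reflection_orthogonal_apply, Submodule.reflection_singleton_apply]
  simp only [RCLike.ofReal_real_eq_id, id, neg_sub, mul_smul, two_smul]

theorem refl_mul_self (β : E n) : refl β * refl β = 1 :=
  Submodule.reflection_mul_reflection _

theorem refl_smul (β : E n) {c : ℝ} (hc : c ≠ 0) : refl (c • β) = refl β := by
  simp only [refl, Submodule.span_singleton_smul_eq (IsUnit.mk0 c hc)]

theorem mul_apply (v w : O n) (x : E n) : (v * w) x = v (w x) := rfl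

theorem refl_map (w : O n) (β : E n) : refl (w β) = w * refl β * w⁻¹ := by
  ext1 x
  rw [refl_apply, mul_apply, mul_apply, refl_apply,
    map_sub, map_smul, w.norm_map]
  have h : w ((w⁻¹ : O n) x) = x := w.apply_symm_apply x
  rw [h]
  nth_rw 2 [← h]
  rw [w.inner_map_map]

/-- `β` is a linear combination of the `α i` with nonnegative coefficients. -/
def IsNonnegComb (α : Fin n → E n) (β : E n) : Prop :=
  ∃ c : Fin n → ℝ, β = ∑ i, c i • α i ∧ ∀ i, 0 ≤ c i

/-- The product of the simple reflections with indices in the list `L`. -/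
noncomputable def word (α : Fin n → E n) (L : List (Fin n)) : O n := (L.map fun i => refl (α i)).prod

theorem word_mem (L : List (Fin n)) : word α L ∈ W α := by
  refine Subgroup.list_prod_mem _ fun x hx => ?_
  obtain ⟨i, -, rfl⟩ := List.mem_map.1 hx
  exact Subgroup.subset_closure ⟨i, rfl⟩

theorem refl_simple_mem (α : Fin n → E n) (i : Fin n) : refl (α i) ∈ W α :=
  Subgroup.subset_closure ⟨i, rfl⟩

theorem exists_word_eq {w : O n} (hw : w ∈ W α) : ∃ L, w = word α L := by
  induction hw using Subgroup.closure_induction with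
  | mem x hx =>
    obtain ⟨i, rfl⟩ := hx
    exact ⟨[i], by simp [word]⟩
  | one => exact ⟨[], by simp [word]⟩
  | mul x y _ _ hx hy =>
    obtain ⟨L, rfl⟩ := hx
    obtain ⟨M, rfl⟩ := hy
    exact ⟨L ++ M, by simp [word]⟩
  | inv x _ hx =>
    obtain ⟨L, rfl⟩ := hx
    refine ⟨L.reverse, ?_⟩
    simp only [word, List.prod_inv_reverse, List.map_map, List.map_reverse]
    congr 3

theorem IsSimpleSystem.ne_zero (hα : IsSimpleSystem α) (i : Fin n) : α i ≠ 0 :=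
  hα.linearIndependent.ne_zero i

theorem IsSimpleSystem.refl_word_mem (L : List (Fin n)) (i : Fin n) :
    refl (word α L (α i)) ∈ W α := by
  rw [refl_map]
  exact mul_mem (mul_mem (word_mem L) (refl_simple_mem α i)) (inv_mem (word_mem L))

theorem IsSimpleSystem.nonneg_or_neg (hα : IsSimpleSystem α) {β : E n} (hβ : β ≠ 0)
    (h : refl β ∈ W α) : IsNonnegComb α β ∨ IsNonnegComb α (-β) := by
  obtain ⟨c, hc, h | h⟩ := hα.root_sign β hβ h
  · exact Or.inl ⟨c, hc, h⟩
  · exact Or.inr ⟨fun i => -c i, by simp [hc], fun i => neg_nonneg.2 (h i)⟩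

/-- A positive root made negative by a simple reflection is a multiple of that simple root. -/
theorem IsSimpleSystem.eq_smul_of_neg (hα : IsSimpleSystem α) {β : E n} {j : Fin n}
    (h : IsNonnegComb α β) (h' : IsNonnegComb α (-(refl (α j) β))) : ∃ c : ℝ, β = c • α j := by
  obtain ⟨c, hc, hc0⟩ := h
  obtain ⟨d, hd, hd0⟩ := h'
  rw [refl_apply] at hd
  set t := 2 * (⟪α j, β⟫ / ‖α j‖ ^ 2)
  refine ⟨c j, ?_⟩
  -- Adding the expansions of β and -s_j β leaves t • α j. So c + d vanishes away from j, and
  -- nonnegativity kills both summands there.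
  have hz : ∑ i, (c i + d i - (Pi.single j t : Fin n → ℝ) i) • α i = 0 := by
    have hs : ∑ i, (Pi.single j t : Fin n → ℝ) i • α i = t • α j := by
      rw [Finset.sum_eq_single j] <;> simp +contextual
    simp only [sub_smul, add_smul, Finset.sum_sub_distrib, Finset.sum_add_distrib, hs, ← hc, ← hd]
    abel
  have hcoef := Fintype.linearIndependent_iff.1 hα.linearIndependent _ hz
  rw [hc, Finset.sum_eq_single j]
  · intro i _ hij
    have := hcoef i
    simp only [Pi.single_apply, hij, if_false, sub_zero] at this
    rw [show c i = 0 by linarith [hc0 i, hd0 i], zero_smul]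
  · simp

/-- Deletion: a word sending a simple root to a negative one is shortened by the corresponding
simple reflection. -/
theorem IsSimpleSystem.nonneg_or_shorter (hα : IsSimpleSystem α) (L : List (Fin n)) (i : Fin n) :
    IsNonnegComb α (word α L (α i)) ∨
      ∃ M : List (Fin n), M.length < L.length ∧ word α L * refl (α i) = word α M := by
  induction L with
  | nil =>
    refine Or.inl ⟨(Pi.single i 1 : Fin n → ℝ), ?_, fun k => ?_⟩
    · rw [Finset.sum_eq_single i] <;> simp +contextual [word]
    · rw [Pi.single_apply]; split_ifs <;> norm_num
  | cons j L ih =>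
    have hcons : ∀ M, word α (j :: M) = refl (α j) * word α M := fun M => by simp [word]
    obtain h | ⟨M, hM, h⟩ := ih
    · have h0 : word α (j :: L) (α i) ≠ 0 := by simpa using hα.ne_zero i
      obtain h1 | h1 := hα.nonneg_or_neg h0 (IsSimpleSystem.refl_word_mem (j :: L) i)
      · exact Or.inl h1
      · right
        refine ⟨L, by simp, ?_⟩
        rw [hcons, mul_apply] at h1
        -- The letter j turns the positive root L α_i negative, so L α_i is a multiple of α_j. Hence
        -- L s_i L⁻¹ = s_j, and s_j L s_i = L.
        obtain ⟨c, hc⟩ := hα.eq_smul_of_neg h h1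
        have hc0 : c ≠ 0 := by
          rintro rfl
          rw [zero_smul] at hc
          exact hα.ne_zero i (by simpa using hc)
        have hr := refl_map (word α L) (α i)
        rw [hc, refl_smul _ hc0] at hr
        rw [hcons, hr]
        simp only [mul_assoc, inv_mul_cancel_left, refl_mul_self, mul_one]
    · exact Or.inr ⟨j :: M, by simpa using hM, by rw [hcons, mul_assoc, h, hcons]⟩

/-- The closed fundamental chamber. -/
def chamber (α : Fin n → E n) : Set (E n) := {x | ∀ i, 0 ≤ ⟪α i, x⟫}

theorem IsNonnegComb.inner_nonneg {β x : E n} (h : IsNonnegComb α β) (hx : x ∈ chamber α) :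
    0 ≤ ⟪β, x⟫ := by
  obtain ⟨c, rfl, hc⟩ := h
  rw [sum_inner]
  refine Finset.sum_nonneg fun i _ => ?_
  rw [real_inner_smul_left]
  exact mul_nonneg (hc i) (hx i)

theorem refl_eq_self {β x : E n} (h : ⟪β, x⟫ = 0) : refl β x = x := by
  rw [refl_apply, h]; simp

/-- The closed chamber meets each orbit in at most one point, and its points have parabolic
stabilisers. -/
theorem IsSimpleSystem.word_fixes (hα : IsSimpleSystem α) {x y : E n} (hx : x ∈ chamber α)
    (hy : y ∈ chamber α) (L : List (Fin n)) (h : word α L x = y) :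
    x = y ∧ ∃ w ∈ parabolic α {i | ⟪α i, x⟫ = 0}, (w : O n) = word α L := by
  induction hk : L.length using Nat.strong_induction_on generalizing L with
  | _ k ih =>
    subst hk
    obtain rfl | ⟨P, i, rfl⟩ := L.eq_nil_or_concat'
    · exact ⟨by simpa [word] using h, 1, one_mem _, by simp [word]⟩
    · have hP : word α (P ++ [i]) = word α P * refl (α i) := by simp [word]
      obtain h1 | ⟨M, hM, h1⟩ := hα.nonneg_or_shorter P i
      · have hi : ⟪α i, x⟫ = 0 := by
          -- P α_i is positive and y = P s_i x lies in the chamber, so 0 ≤ ⟪P α_i, y⟫ = ⟪α_i, s_i x⟫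
          -- = -⟪α_i, x⟫.
          refine le_antisymm ?_ (hx i)
          have h2 := h1.inner_nonneg hy
          rw [← h, hP, mul_apply, LinearIsometryEquiv.inner_map_map,
            refl_apply, inner_sub_right, real_inner_smul_right, real_inner_self_eq_norm_sq] at h2
          have h3 : ‖α i‖ ^ 2 ≠ 0 := by simpa using hα.ne_zero i
          rw [mul_assoc, div_mul_cancel₀ _ h3] at h2
          linarith
        rw [hP, mul_apply, refl_eq_self hi] at h
        obtain ⟨hxy, w, hw, hwP⟩ := ih P.length (by simp) P h rfl
        refine ⟨hxy, w * ⟨refl (α i), refl_simple_mem α i⟩,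
          mul_mem hw (Subgroup.subset_closure ⟨i, hi, rfl⟩), ?_⟩
        rw [hP, ← hwP]; rfl
      · rw [hP, h1] at h ⊢
        exact ih M.length (by simp; omega) M h rfl

theorem facet_subset_chamber {K : Set (Fin n)} : facet α K ⊆ chamber α := by
  intro x hx i
  by_cases hi : i ∈ K
  · exact ((hx i).1 hi).ge
  · exact ((hx i).2 hi).le

theorem inner_eq_zero_iff_of_mem_facet {K : Set (Fin n)} {x : E n} (hx : x ∈ facet α K)
    (i : Fin n) : ⟪α i, x⟫ = 0 ↔ i ∈ K :=
  ⟨fun h => by_contra fun hi => ((hx i).2 hi).ne' h, (hx i).1⟩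

theorem IsSimpleSystem.eq_of_mem_facet (hα : IsSimpleSystem α) {I J : Set (Fin n)} {x y : E n}
    (hx : x ∈ facet α I) (hy : y ∈ facet α J) {w : W α} (h : (w : O n) x = y) : I = J := by
  obtain ⟨L, hL⟩ := exists_word_eq w.2
  rw [hL] at h
  obtain ⟨rfl, -⟩ :=
    hα.word_fixes (facet_subset_chamber hx) (facet_subset_chamber hy) L h
  ext i
  rw [← inner_eq_zero_iff_of_mem_facet hx, inner_eq_zero_iff_of_mem_facet hy]

/-- Generators of W_I fix x by the facet equations; conversely, `word_fixes` with y = x applies,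
since the simple roots orthogonal to x are exactly those indexed by I. -/
theorem IsSimpleSystem.mem_parabolic_iff (hα : IsSimpleSystem α) {I : Set (Fin n)} {x : E n}
    (hx : x ∈ facet α I) {w : W α} : w ∈ parabolic α I ↔ (w : O n) x = x := by
  constructor
  · intro hw
    induction hw using Subgroup.closure_induction with
    | mem w h =>
      obtain ⟨i, hi, h⟩ := h
      rw [h, refl_eq_self ((hx i).1 hi)]
    | one => rfl
    | mul v w _ _ hv hw =>
      rw [Subgroup.coe_mul, mul_apply, hw, hv]
    | inv v _ hv =>
      rw [Subgroup.coe_inv]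
      exact (LinearIsometryEquiv.symm_apply_eq _).2 hv.symm
  · intro h
    obtain ⟨L, hL⟩ := exists_word_eq w.2
    rw [hL] at h
    have hc := facet_subset_chamber hx
    obtain ⟨-, v, hv, hvL⟩ := hα.word_fixes hc hc L h
    have : {i | ⟪α i, x⟫ = 0} = I := by
      ext i
      exact inner_eq_zero_iff_of_mem_facet hx i
    rw [this] at hv
    rwa [show w = v from Subtype.ext (hL.trans hvL.symm)]

end Geometry

/-! ### Fixed points in an orbit, and sums over conjugacy classes -/

section Counting

open MulAction

variable {G X : Type*} [Group G] [MulAction G X]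

/-- The number of points of the orbit of `a` fixed by `g`. -/
noncomputable def fixCount (a : X) (g : G) : ℕ := {x | x ∈ orbit G a ∧ g • x = x}.ncard

theorem finite_orbit [Finite G] (x : X) : (orbit G x).Finite := Set.finite_range _

instance [Finite G] : Finite (ConjAct G) := inferInstanceAs (Finite G)

/-- Nonempty fibres of g ↦ g • x are left cosets of the stabiliser. This serves both the given
action and conjugation. -/
theorem ncard_smul_mem [Finite G] (x : X) (A : Set X) :
    {g : G | g • x ∈ A}.ncard = (A ∩ orbit G x).ncard * Nat.card (stabilizer G x) := by
  classical
  have := Fintype.ofFinite G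
  have hfin : (A ∩ orbit G x).Finite := (finite_orbit x).inter_of_right _
  rw [Set.ncard_eq_toFinset_card', Set.ncard_eq_toFinset_card _ hfin,
    Finset.card_eq_sum_card_fiberwise (f := fun g : G => g • x) (t := hfin.toFinset)
      (fun g hg => by simpa using hg), Finset.sum_const_nat]
  intro y hy
  obtain ⟨hyA, g, rfl⟩ := (Set.Finite.mem_toFinset _).1 hy
  rw [← SetLike.coe_sort_coe, Nat.card_eq_card_toFinset,
    ← Finset.card_map (s := (stabilizer G x : Set G).toFinset) (mulLeftEmbedding g)]
  refine congrArg Finset.card (Finset.ext fun h => ?_)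
  simp only [Finset.mem_filter, Set.mem_toFinset, Set.mem_ofPred_eq, Finset.mem_map,
    mulLeftEmbedding_apply, SetLike.mem_coe, mem_stabilizer_iff]
  constructor
  · rintro ⟨-, h1⟩
    exact ⟨g⁻¹ * h, by simp [mul_smul, h1], by simp⟩
  · rintro ⟨k, hk, rfl⟩
    simpa [mul_smul, hk] using hyA

/-- u fixes g • a iff g⁻¹ u g fixes a. Both sides count such g: by the point g • a on the left, by
the conjugate g⁻¹ u g on the right. -/
theorem fixCount_mul_card_stabilizer [Finite G] (a : X) (u : G) :
    fixCount a u * Nat.card (stabilizer G a) =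
      (conjIn (stabilizer G a) u).ncard * Nat.card (Subgroup.centralizer ({u} : Set G)) := by
  have h1 := ncard_smul_mem (G := G) a {x | u • x = x}
  have h2 := ncard_smul_mem (G := ConjAct G) u (stabilizer G a : Set G)
  have hc : Nat.card (stabilizer (ConjAct G) u) =
      Nat.card (Subgroup.centralizer ({u} : Set G)) := by
    rw [ConjAct.stabilizer_eq_centralizer]; rfl
  have hi : ((stabilizer G a : Set G) ∩ orbit (ConjAct G) u) = conjIn (stabilizer G a) u := by
    ext v
    simp only [conjIn, Set.mem_inter_iff, SetLike.mem_coe, ConjAct.mem_orbit_conjAct,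
      Set.mem_ofPred_eq, isConj_comm]
  have hf : ({x | u • x = x} ∩ orbit G a).ncard = fixCount a u := by
    rw [fixCount, Set.inter_comm]; rfl
  rw [hc, hi] at h2
  rw [hf] at h1
  rw [← h1, ← h2]
  refine Set.ncard_congr (fun g _ => ConjAct.toConjAct g⁻¹) ?_ ?_ ?_
  · intro g hg
    simp only [Set.mem_ofPred_eq, ConjAct.toConjAct_smul, SetLike.mem_coe, mem_stabilizer_iff,
      inv_inv, mul_smul] at hg ⊢
    rw [hg, inv_smul_smul]
  · intro g h _ _ hgh
    simpa using hgh
  · intro g hg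
    refine ⟨(ConjAct.ofConjAct g)⁻¹, ?_, by simp⟩
    simp only [Set.mem_ofPred_eq, ConjAct.smul_def, SetLike.mem_coe, mem_stabilizer_iff,
      mul_smul] at hg ⊢
    rwa [eq_inv_smul_iff]

/-- This also holds when the stabiliser contains no conjugate of u: `centIn` is then a division by
zero, hence 0, and both sides vanish. -/
theorem fixCount_eq [Finite G] (a : X) (u : G) :
    (fixCount a u : ℚ) = cent u / centIn (stabilizer G a) u := by
  have h : (fixCount a u : ℚ) * Nat.card (stabilizer G a) =
      (conjIn (stabilizer G a) u).ncard * cent u := by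
    rw [cent]
    exact_mod_cast fixCount_mul_card_stabilizer a u
  have h0 : (Nat.card (stabilizer G a) : ℚ) ≠ 0 := by exact_mod_cast Nat.card_pos.ne'
  rw [centIn, div_div_eq_mul_div, eq_div_iff h0, h, mul_comm]

theorem fixCount_eq_of_isConj (a : X) {u v : G} (h : IsConj u v) :
    fixCount a u = fixCount a v := by
  obtain ⟨c, rfl⟩ := isConj_iff.1 h
  refine Set.ncard_congr (fun x _ => c • x) ?_ (fun x y _ _ hxy => smul_left_cancel c hxy) ?_
  · rintro x ⟨hx, hu⟩
    exact ⟨mem_orbit_of_mem_orbit c hx, by simp [mul_smul, hu]⟩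
  · rintro x ⟨hx, hu⟩
    refine ⟨c⁻¹ • x, ⟨mem_orbit_of_mem_orbit c⁻¹ hx, ?_⟩, by simp⟩
    rw [eq_inv_smul_iff]
    simpa [mul_smul] using hu

theorem mem_classHull_of_fixCount_ne_zero (a : X) {u : G} (h : fixCount a u ≠ 0) :
    u ∈ classHull (stabilizer G a : Set G) := by
  obtain ⟨x, ⟨g, rfl⟩, hx⟩ := Set.nonempty_of_ncard_ne_zero h
  refine ⟨g⁻¹ * u * g, ?_, isConj_iff.2 ⟨g⁻¹, by simp⟩⟩
  simp only [SetLike.mem_coe, mem_stabilizer_iff, mul_smul]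
  rw [inv_smul_eq_iff]
  exact hx

/-- Burnside for the transitive action on one orbit; this is the source of the -1 in the homoorbital
formula. -/
theorem fixCount_sum [Fintype G] (a : X) : ∑ g : G, fixCount a g = Fintype.card G := by
  classical
  have := (finite_orbit (G := G) a).fintype
  have h := sum_card_fixedBy_eq_card_orbits_mul_card_group G (orbit G a)
  have h1 : Fintype.card (Quotient (orbitRel G (orbit G a))) = 1 := by
    have : Nonempty (orbit G a) := ⟨⟨a, mem_orbit_self a⟩⟩
    have := pretransitive_iff_unique_quotient_of_nonempty G (orbit G a) |>.1 inferInstance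
    exact Fintype.card_eq_one_iff_nonempty_unique.2 this
  rw [h1, one_mul] at h
  rw [← h]
  refine Finset.sum_congr rfl fun g _ => ?_
  rw [fixCount, ← Nat.card_eq_fintype_card, Nat.card_coe_set_eq,
    ← Set.ncard_image_of_injective _ Subtype.val_injective]
  congr 1
  ext x
  simp [Subtype.ext_iff, and_comm]

theorem ncard_isConj_mul_cent [Finite G] (u : G) :
    {v : G | IsConj u v}.ncard * Nat.card (Subgroup.centralizer ({u} : Set G)) = Nat.card G := by
  have h := ncard_smul_mem (G := ConjAct G) u Set.univ
  have hc : Nat.card (stabilizer (ConjAct G) u) =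
      Nat.card (Subgroup.centralizer ({u} : Set G)) := by
    rw [ConjAct.stabilizer_eq_centralizer]; rfl
  have hi : (Set.univ ∩ orbit (ConjAct G) u) = {v : G | IsConj u v} := by
    ext v
    simp only [Set.univ_inter, ConjAct.mem_orbit_conjAct, Set.mem_ofPred_eq]
    exact isConj_comm
  rw [hc, hi] at h
  rw [← h]
  simp [Set.ncard_univ]
  rfl

theorem cent_ne_zero [Finite G] (u : G) : cent u ≠ 0 := by
  rw [cent]; exact_mod_cast Nat.card_pos.ne'

/-- A sum of a class function over a group is a sum over representatives of classes. -/
theorem sum_eq_card_mul_sum_reps [Fintype G] {R : Finset G} {A : Set G} (hR : IsClassReps R A)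
    (hA : ∀ u v, IsConj u v → v ∈ A → u ∈ A) (F : G → ℚ) (hF : ∀ u v, IsConj u v → F u = F v)
    (h0 : ∀ u, F u ≠ 0 → u ∈ A) :
    ∑ g, F g = Fintype.card G * ∑ u ∈ R, F u / cent u := by
  classical
  have h1 : ∑ g, F g = ∑ g with g ∈ A, F g := by
    rw [Finset.sum_filter_of_ne]
    exact fun g _ h => h0 g h
  choose! r hr using hR.2
  rw [h1, ← Finset.sum_fiberwise_of_maps_to (g := r) (t := R)
    (fun g hg => (hr g (Finset.mem_filter.1 hg).2).1.1), Finset.mul_sum]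
  refine Finset.sum_congr rfl fun u hu => ?_
  -- The fibre of the choice of representative over u is the whole conjugacy class of u.
  have hfib : ({g ∈ ({g | g ∈ A} : Finset G) | r g = u} : Finset G) =
      ({g | IsConj u g} : Finset G) := by
    ext g
    simp only [Finset.mem_filter, Finset.mem_univ, true_and]
    constructor
    · rintro ⟨hg, rfl⟩
      exact (hr g hg).1.2
    · intro h
      have hg := hA g u h.symm (hR.1 u hu)
      exact ⟨hg, ((hr g hg).2 u ⟨hu, h⟩).symm⟩
  rw [hfib, Finset.sum_congr rfl (g := fun _ => F u)
    (fun g hg => (hF u g (Finset.mem_filter.1 hg).2).symm), Finset.sum_const, nsmul_eq_mul]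
  have h2 : (({g | IsConj u g} : Finset G).card : ℚ) * cent u = Fintype.card G := by
    have := ncard_isConj_mul_cent u
    rw [Set.ncard_eq_toFinset_card', Set.toFinset_ofPred, Nat.card_eq_fintype_card (α := G)] at this
    rw [cent]
    exact_mod_cast this
  rw [← h2]
  field_simp [cent_ne_zero u]

end Counting

/-! ### Unordered pairs invariant under a group element -/

section FixedPairs

open MulAction

variable {G X : Type*} [Group G] [MulAction G X]

/-- The nondegenerate unordered pairs with one point in the orbit of `a`, the other in that of `b`,
which are mapped to themselves by `g`. -/
def fixedPairs (a b : X) (g : G) : Set (Sym2 X) :=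
  {z | (¬ z.IsDiag ∧ ∃ v w : G, z = s(v • a, w • b)) ∧ Sym2.map (g • ·) z = z}

/-- A swap would carry a point of one orbit into the other, so both endpoints of an invariant pair
are fixed. -/
theorem ncard_fixedPairs_of_disjoint (a b : X) (h : ∀ v w : G, v • a ≠ w • b) (g : G) :
    (fixedPairs a b g).ncard = fixCount a g * fixCount b g := by
  rw [fixCount, fixCount, ← Set.ncard_prod]
  symm
  refine Set.ncard_congr (fun p _ => s(p.1, p.2)) ?_ ?_ ?_
  · rintro ⟨_, _⟩ ⟨⟨⟨v, rfl⟩, hv⟩, ⟨w, rfl⟩, hw⟩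
    exact ⟨⟨by simpa using h v w, v, w, rfl⟩, by simp only [Sym2.map_mk, hv, hw]⟩
  · rintro ⟨_, _⟩ ⟨_, _⟩ ⟨⟨⟨v, rfl⟩, _⟩, ⟨w, rfl⟩, _⟩ ⟨⟨⟨v', rfl⟩, _⟩, ⟨w', rfl⟩, _⟩ hp
    obtain ⟨h1, h2⟩ | ⟨h1, h2⟩ := Sym2.eq_iff.1 hp
    · exact Prod.ext h1 h2
    · exact absurd h1 (h v w')
  · rintro _ ⟨⟨_, v, w, rfl⟩, hg⟩
    rw [Sym2.map_mk] at hg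
    obtain ⟨h1, h2⟩ | ⟨h1, h2⟩ := Sym2.eq_iff.1 hg
    · exact ⟨(v • a, w • b), ⟨⟨⟨v, rfl⟩, h1⟩, ⟨w, rfl⟩, h2⟩, rfl⟩
    · exact absurd ((mul_smul g v a).trans h1) (h (g * v) w)

theorem two_mul_card_image_mk {Y : Type*} [DecidableEq Y] (D : Finset (Y × Y))
    (hne : ∀ p ∈ D, p.1 ≠ p.2) (hswap : ∀ p ∈ D, p.swap ∈ D) :
    2 * (D.image fun p => s(p.1, p.2)).card = D.card := by
  rw [Finset.card_eq_sum_card_image (fun p : Y × Y => s(p.1, p.2)) D, Finset.sum_const_nat,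
    mul_comm]
  intro z hz
  obtain ⟨⟨x, y⟩, hp, rfl⟩ := Finset.mem_image.1 hz
  rw [← Finset.card_pair (a := (x, y)) (b := (y, x))
    (fun h => hne _ hp (Prod.ext_iff.1 h).1)]
  congr 1
  ext ⟨u, v⟩
  simp only [Finset.mem_filter, Sym2.eq_iff, Finset.mem_insert, Finset.mem_singleton,
    Prod.mk.injEq]
  constructor
  · exact And.right
  · rintro (⟨rfl, rfl⟩ | ⟨rfl, rfl⟩)
    · exact ⟨hp, Or.inl ⟨rfl, rfl⟩⟩
    · exact ⟨hswap _ hp, Or.inr ⟨rfl, rfl⟩⟩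

/-- An invariant pair consists of two fixed points of g, or of a point fixed by g² but not by g
together with its image. Counted as ordered pairs, these number f² - f and f₂ - f. -/
theorem two_mul_ncard_fixedPairs [Finite G] (a : X) (g : G) :
    2 * (fixedPairs a a g).ncard + 2 * fixCount a g = fixCount a g ^ 2 + fixCount a (g ^ 2) := by
  classical
  set A : Finset X := (finite_orbit (G := G) a).toFinset with hA
  have hmem : ∀ x, x ∈ A ↔ x ∈ orbit G a := fun x => by simp [hA]
  have hcount : ∀ k : G, fixCount a k = (A.filter fun x => k • x = x).card := fun k => by
    rw [fixCount, ← Set.ncard_coe_finset]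
    congr 1
    ext x
    simp [hmem]
  set F := A.filter fun x => g • x = x
  set F₂ := A.filter fun x => g ^ 2 • x = x
  have hsq : ∀ x : X, g ^ 2 • x = g • g • x := fun x => by rw [pow_two, mul_smul]
  have hFF : F ⊆ F₂ := by
    intro x hx
    obtain ⟨h1, h2⟩ := Finset.mem_filter.1 hx
    exact Finset.mem_filter.2 ⟨h1, by rw [hsq, h2, h2]⟩
  set B := (F₂ \ F).image fun x => (x, g • x)
  set D := F.offDiag ∪ B
  have hB : ∀ p : X × X, p ∈ B ↔
      p.1 ∈ A ∧ p.1 ≠ p.2 ∧ g • p.1 = p.2 ∧ g • p.2 = p.1 := by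
    rintro ⟨x, y⟩
    simp only [B, F, F₂, Finset.mem_image, Finset.mem_sdiff, Finset.mem_filter, Prod.mk.injEq, hsq]
    constructor
    · rintro ⟨x, ⟨⟨h1, h2⟩, h3⟩, rfl, rfl⟩
      exact ⟨h1, fun h => h3 ⟨h1, h.symm⟩, rfl, h2⟩
    · rintro ⟨h1, h2, rfl, h3⟩
      exact ⟨x, ⟨⟨h1, h3⟩, fun h => h2 h.2.symm⟩, rfl, rfl⟩
  have hD : ∀ p : X × X, p ∈ D ↔ p.1 ∈ A ∧ p.2 ∈ A ∧ p.1 ≠ p.2 ∧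
      Sym2.map (g • ·) s(p.1, p.2) = s(p.1, p.2) := by
    intro p
    rw [Finset.mem_union, hB, Sym2.map_mk, Sym2.eq_iff, Finset.mem_offDiag, Finset.mem_filter,
      Finset.mem_filter]
    constructor
    · rintro (⟨⟨h1, h2⟩, ⟨h3, h4⟩, h5⟩ | ⟨h1, h2, h3, h4⟩)
      · exact ⟨h1, h3, h5, Or.inl ⟨h2, h4⟩⟩
      · refine ⟨h1, ?_, h2, Or.inr ⟨h3, h4⟩⟩
        rw [hmem] at h1 ⊢
        rw [← h3]
        exact mem_orbit_of_mem_orbit g h1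
    · rintro ⟨h1, h2, h3, ⟨h4, h5⟩ | ⟨h4, h5⟩⟩
      · exact Or.inl ⟨⟨h1, h4⟩, ⟨h2, h5⟩, h3⟩
      · exact Or.inr ⟨h1, h3, h4, h5⟩
  have himage : fixedPairs a a g = (D.image fun p => s(p.1, p.2) : Finset (Sym2 X)) := by
    ext z
    induction z with | _ x y
    simp only [fixedPairs, Set.mem_ofPred_eq, Finset.coe_image, Set.mem_image, Finset.mem_coe,
      Sym2.mk_isDiag_iff]
    constructor
    · rintro ⟨⟨h1, v, w, h2⟩, h3⟩
      refine ⟨(v • a, w • a), (hD _).2 ⟨(hmem _).2 ⟨v, rfl⟩, (hmem _).2 ⟨w, rfl⟩, ?_, ?_⟩, h2.symm⟩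
      · rwa [← Sym2.mk_isDiag_iff, h2, Sym2.mk_isDiag_iff] at h1
      · rwa [h2] at h3
    · rintro ⟨p, hp, h⟩
      obtain ⟨h1, h2, h3, h4⟩ := (hD p).1 hp
      obtain ⟨v, hv⟩ := (hmem _).1 h1
      obtain ⟨w, hw⟩ := (hmem _).1 h2
      rw [← Sym2.mk_isDiag_iff, ← h, Sym2.mk_isDiag_iff]
      exact ⟨⟨h3, v, w, by rw [← hv, ← hw]⟩, h4⟩
  have hcard : D.card = (F.card * F.card - F.card) + (F₂.card - F.card) := by
    rw [Finset.card_union_of_disjoint, Finset.offDiag_card,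
      Finset.card_image_of_injective _ (fun x y h => (Prod.ext_iff.1 h).1),
      Finset.card_sdiff_of_subset hFF]
    rw [Finset.disjoint_left]
    intro p h1 h2
    rw [Finset.mem_offDiag] at h1
    rw [hB] at h2
    exact h2.2.1 ((Finset.mem_filter.1 h1.1).2.symm.trans h2.2.2.1)
  rw [hcount, hcount, himage, Set.ncard_coe_finset, two_mul_card_image_mk, hcard]
  · change _ + 2 * F.card = F.card ^ 2 + F₂.card
    -- These bounds make the truncated subtractions in `hcard` exact.
    have h1 := Finset.card_le_card hFF
    have h2 : F.card ≤ F.card * F.card := Nat.le_mul_self _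
    rw [pow_two]
    omega
  · exact fun p hp => ((hD p).1 hp).2.2.1
  · intro p hp
    obtain ⟨h1, h2, h3, h4⟩ := (hD p).1 hp
    exact (hD _).2 ⟨h2, h1, h3.symm, by simpa only [Prod.fst_swap, Prod.snd_swap, Sym2.eq_swap] using h4⟩

end FixedPairs

/-! ### Polypolyhedra and univalent struts as orbits of struts -/

section Orbits

variable {n : ℕ} {α : Fin n → E n}

theorem move_injective (w : W α) : Function.Injective (move w) :=
  Sym2.map.injective (w : O n).injective

theorem IsRotation.one : IsRotation (1 : W α) := LinearMap.det_id

theorem det_mul (v w : O n) :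
    LinearMap.det ((v * w).toLinearEquiv : E n →ₗ[ℝ] E n) =
      LinearMap.det (v.toLinearEquiv : E n →ₗ[ℝ] E n) *
        LinearMap.det (w.toLinearEquiv : E n →ₗ[ℝ] E n) :=
  LinearMap.det_comp _ _

theorem IsRotation.mul {v w : W α} (hv : IsRotation v) (hw : IsRotation w) :
    IsRotation (v * w) := by
  rw [IsRotation, Subgroup.coe_mul, det_mul, hv, hw, one_mul]

theorem IsRotation.conj {r : W α} (hr : IsRotation r) (w : W α) : IsRotation (w * r * w⁻¹) := by
  rw [IsRotation, Subgroup.coe_mul, Subgroup.coe_mul, det_mul, det_mul, hr, mul_one, ← det_mul,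
    ← Subgroup.coe_mul, mul_inv_cancel]
  exact IsRotation.one

theorem IsRotation.inv {r : W α} (hr : IsRotation r) : IsRotation r⁻¹ := by
  have h := det_mul (r : O n) ((r⁻¹ : W α) : O n)
  rw [hr, one_mul, ← Subgroup.coe_mul, mul_inv_cancel] at h
  exact h.symm.trans IsRotation.one

theorem mem_generated_self (x : Sym2 (E n)) : x ∈ generated α x :=
  ⟨1, IsRotation.one, (move_one x).symm⟩

/-- Rotations are stable under conjugation by `W`. -/
theorem generated_move (w : W α) (x : Sym2 (E n)) :
    generated α (move w x) = move w '' generated α x := by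
  ext y
  constructor
  · rintro ⟨r, hr, rfl⟩
    refine ⟨move (w⁻¹ * r * w) x, ⟨_, by simpa using hr.conj w⁻¹, rfl⟩, ?_⟩
    simp only [← move_mul]
    congr 1
    group
  · rintro ⟨_, ⟨r, hr, rfl⟩, rfl⟩
    refine ⟨w * r * w⁻¹, hr.conj w, ?_⟩
    simp only [← move_mul]
    congr 1
    group

theorem generated_move_rotation {r : W α} (hr : IsRotation r) (x : Sym2 (E n)) :
    generated α (move r x) = generated α x := by
  ext y
  constructor
  · rintro ⟨q, hq, rfl⟩
    exact ⟨q * r, hq.mul hr, (move_mul _ _ _).symm⟩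
  · rintro ⟨q, hq, rfl⟩
    exact ⟨q * r⁻¹, hq.mul hr.inv, by rw [← move_mul, inv_mul_cancel_right]⟩

theorem valency_image_move (w : W α) (Q : Set (Sym2 (E n))) (v : E n) :
    valency (move w '' Q) ((w : O n) v) = valency Q v := by
  rw [valency, valency, ← (move_injective w).encard_image {y | y ∈ Q ∧ v ∈ y}]
  congr 1
  ext y
  constructor
  · rintro ⟨⟨z, hz, rfl⟩, hv⟩
    obtain ⟨u, hu, huv⟩ := Sym2.mem_map.1 hv
    rw [(w : O n).injective huv] at hu
    exact ⟨z, ⟨hz, hu⟩, rfl⟩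
  · rintro ⟨z, ⟨hz, hv⟩, rfl⟩
    exact ⟨⟨z, hz, rfl⟩, Sym2.mem_map.2 ⟨v, hv, rfl⟩⟩

theorem IsUnivalent.move {x : Sym2 (E n)} (h : IsUnivalent α x) (w : W α) :
    IsUnivalent α (move w x) := by
  obtain ⟨v, hv, h⟩ := h
  exact ⟨(w : O n) v, Sym2.mem_map.2 ⟨v, hv, rfl⟩, by rw [generated_move, valency_image_move, h]⟩

/-- Rotations preserve the generated set and its valencies, and carry endpoints of x to every other
endpoint, so only the two endpoints of x need checking. Their valency is nonzero because x itself is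
incident. -/
theorem isPolypolyhedron_generated_iff {a b : E n} {x : Sym2 (E n)} (hx : x ∈ struts α a b) :
    IsPolypolyhedron α a b (generated α x) ↔ ¬ IsUnivalent α x := by
  constructor
  · rintro ⟨-, h⟩ ⟨v, hv, h1⟩
    have := h v ⟨x, mem_generated_self x, hv⟩
    rw [h1] at this
    exact absurd this (by decide)
  · refine fun h => ⟨⟨x, hx, rfl⟩, ?_⟩
    rintro v ⟨y, ⟨r, hr, rfl⟩, hv⟩
    obtain ⟨u, hu, rfl⟩ := Sym2.mem_map.1 hv
    rw [← generated_move_rotation hr, generated_move, valency_image_move]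
    have h0 : valency (generated α x) u ≠ 0 := by
      rw [valency, Set.encard_ne_zero]
      exact ⟨x, mem_generated_self x, hu⟩
    have h1 : valency (generated α x) u ≠ 1 := fun h1 => h ⟨u, hu, h1⟩
    rw [← one_add_one_eq_two]
    exact Order.add_one_le_of_lt
      (lt_of_le_of_ne (Order.one_le_iff_pos.2 (pos_iff_ne_zero.2 h0)) h1.symm)

theorem move_mem_struts {a b : E n} {x : Sym2 (E n)} (hx : x ∈ struts α a b) (w : W α) :
    move w x ∈ struts α a b := by
  obtain ⟨h, u, v, rfl⟩ := hx
  refine ⟨fun hd => h ?_, w * u, w * v, rfl⟩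
  simpa [move] using hd

noncomputable instance strutsAction (a b : E n) : MulAction (W α) (struts α a b) where
  smul w x := ⟨move w x.1, move_mem_struts x.2 w⟩
  one_smul x := Subtype.ext (move_one x.1)
  mul_smul v w x := Subtype.ext (move_mul v w x.1)

theorem numPoly_add_numUnivalent [Finite (W α)] (a b : E n) [Finite (struts α a b)] :
    numPoly α a b + numUnivalent α a b =
      Nat.card (Quotient (MulAction.orbitRel (W α) (struts α a b))) := by
  classical
  let f : struts α a b → Quotient (polySetoid α a b) ⊕ Quotient (univalentSetoid α a b) :=
    fun x => if h : IsUnivalent α x.1 then Sum.inr (Quotient.mk _ ⟨x.1, x.2, h⟩)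
      else Sum.inl (Quotient.mk _ ⟨generated α x.1, (isPolypolyhedron_generated_iff x.2).2 h⟩)
  have hpos : ∀ (x : struts α a b) (h : IsUnivalent α x.1),
      f x = Sum.inr (Quotient.mk _ ⟨x.1, x.2, h⟩) := fun x h => dif_pos h
  have hneg : ∀ (x : struts α a b) (h : ¬ IsUnivalent α x.1),
      f x = Sum.inl (Quotient.mk _
        ⟨generated α x.1, (isPolypolyhedron_generated_iff x.2).2 h⟩) := fun x h => dif_neg h
  have hsurj : Function.Surjective f := by
    rintro (q | q)
    · induction q using Quotient.inductionOn with | _ Q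
      obtain ⟨_, hQ⟩ := Q
      obtain ⟨x, hx, rfl⟩ := hQ.1
      exact ⟨⟨x, hx⟩, hneg _ ((isPolypolyhedron_generated_iff hx).1 hQ)⟩
    · induction q using Quotient.inductionOn with | _ Q
      obtain ⟨x, hx, hu⟩ := Q
      exact ⟨⟨x, hx⟩, hpos _ hu⟩
  have hker : Setoid.ker f = MulAction.orbitRel (W α) (struts α a b) := by
    ext x y
    rw [Setoid.ker_def, MulAction.orbitRel_apply]
    constructor
    · intro h
      simp only [f] at h
      suffices h' : ∃ w : W α, move w y.1 = x.1 by
        obtain ⟨w, hw⟩ := h'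
        exact ⟨w, Subtype.ext hw⟩
      split_ifs at h with h1 h2 h2
      · obtain ⟨w, hw⟩ := Quotient.exact (Sum.inr_injective h).symm
        exact ⟨w, hw⟩
      · obtain ⟨w, hw⟩ := Quotient.exact (Sum.inl_injective h).symm
        -- If w maps the set generated by y onto that of x, then x = w r y for some rotation r, so x
        -- and y share an orbit.
        have hx : x.1 ∈ move w '' generated α y.1 := by
          rw [show move w '' generated α y.1 = generated α x.1 from hw]
          exact mem_generated_self _
        obtain ⟨_, ⟨r, _, rfl⟩, h⟩ := hx
        exact ⟨w * r, (move_mul _ _ _).trans h⟩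
    · rintro ⟨w, rfl⟩
      have hiff : IsUnivalent α (move w y.1) ↔ IsUnivalent α y.1 :=
        ⟨fun h => by simpa [← move_mul, move_one] using h.move w⁻¹, fun h => h.move w⟩
      by_cases h : IsUnivalent α y.1
      · rw [hpos y h, hpos (w • y) (hiff.2 h)]
        refine congrArg Sum.inr (Quotient.sound ?_).symm
        exact ⟨w, rfl⟩
      · rw [hneg y h, hneg (w • y) (mt hiff.1 h)]
        refine congrArg Sum.inl (Quotient.sound ?_).symm
        exact ⟨w, (generated_move w y.1).symm⟩
  have := Finite.of_surjective f hsurj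
  have : Finite (Quotient (polySetoid α a b)) :=
    Finite.of_injective _ (Sum.inl_injective (β := Quotient (univalentSetoid α a b)))
  have : Finite (Quotient (univalentSetoid α a b)) :=
    Finite.of_injective _ (Sum.inr_injective (α := Quotient (polySetoid α a b)))
  rw [numPoly, numUnivalent, ← Nat.card_sum, ← hker]
  exact (Nat.card_congr (Setoid.quotientKerEquivOfSurjective f hsurj)).symm

end Orbits

/-! ### Burnside's lemma for struts -/

section Count

open MulAction

variable {n : ℕ} {α : Fin n → E n}

noncomputable instance pointAction (α : Fin n → E n) : MulAction (W α) (E n) where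
  smul w x := (w : O n) x
  one_smul _ := rfl
  mul_smul _ _ _ := rfl

theorem smul_point_def (w : W α) (x : E n) : w • x = (w : O n) x := rfl

theorem IsSimpleSystem.stabilizer_eq (hα : IsSimpleSystem α) {I : Set (Fin n)} {x : E n}
    (hx : x ∈ facet α I) : stabilizer (W α) x = parabolic α I := by
  ext w
  rw [mem_stabilizer_iff, hα.mem_parabolic_iff hx, smul_point_def]

theorem finite_struts [Finite (W α)] (a b : E n) : (struts α a b).Finite := by
  refine (Set.finite_range fun p : W α × W α => s((p.1 : O n) a, (p.2 : O n) b)).subset ?_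
  rintro _ ⟨-, v, w, rfl⟩
  exact ⟨(v, w), rfl⟩

theorem sum_ncard_fixedPairs [Fintype (W α)] (a b : E n) :
    ∑ w : W α, (fixedPairs a b w).ncard =
      (numPoly α a b + numUnivalent α a b) * Fintype.card (W α) := by
  classical
  have := (finite_struts (α := α) a b).fintype
  rw [numPoly_add_numUnivalent, Nat.card_eq_fintype_card,
    ← sum_card_fixedBy_eq_card_orbits_mul_card_group]
  refine Finset.sum_congr rfl fun w _ => ?_
  rw [← Nat.card_eq_fintype_card, Nat.card_coe_set_eq,
    ← Set.ncard_image_of_injective _ Subtype.val_injective]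
  congr 1
  ext z
  constructor
  · rintro ⟨h, hz⟩
    exact ⟨⟨z, h⟩, Subtype.ext hz, rfl⟩
  · rintro ⟨⟨z, h⟩, hz, rfl⟩
    exact ⟨h, congrArg Subtype.val hz⟩

end Count

/-! ### Conjugacy-invariance, and assembly of the two formulas -/

section ClassFunctions

variable {G : Type*} [Group G]

theorem mem_classHull_of_isConj {A : Set G} {u v : G} (h : IsConj u v) (hv : v ∈ classHull A) :
    u ∈ classHull A := by
  obtain ⟨a, ha, hva⟩ := hv
  exact ⟨a, ha, h.trans hva⟩

theorem mem_classHull_sqrtSet {H : Subgroup G} {w : G} (h : w ^ 2 ∈ classHull (H : Set G)) :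
    w ∈ classHull (sqrtSet H) := by
  obtain ⟨a, ha, hw⟩ := h
  obtain ⟨c, rfl⟩ := isConj_iff.1 hw
  exact ⟨c * w * c⁻¹, by simpa [sqrtSet, conj_pow] using ha, isConj_iff.2 ⟨c, rfl⟩⟩

theorem isConj_sq {u v : G} (h : IsConj u v) : IsConj (u ^ 2) (v ^ 2) := by
  obtain ⟨c, rfl⟩ := isConj_iff.1 h
  exact isConj_iff.2 ⟨c, conj_pow.symm⟩

end ClassFunctions

theorem numPoly_of_ne {n : ℕ} {α : Fin n → E n} (hα : IsSimpleSystem α) {I J : Set (Fin n)}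
    {a b : E n} (ha : a ∈ facet α I) (hb : b ∈ facet α J) (hIJ : I ≠ J) {R : Finset (W α)}
    (hR : IsClassReps R (classHull (parabolic α I : Set (W α)) ∩
      classHull (parabolic α J : Set (W α)))) :
    (numPoly α a b : ℚ) = (∑ u ∈ R, cent u /
      (centIn (parabolic α I) u * centIn (parabolic α J) u)) - numUnivalent α a b := by
  have := hα.finite
  have := Fintype.ofFinite (W α)
  have hdisj : ∀ v w : W α, v • a ≠ w • b := by
    intro v w h
    refine hIJ (hα.eq_of_mem_facet ha hb (w := w⁻¹ * v) ?_)
    rw [← smul_point_def, mul_smul, inv_smul_eq_iff, h]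
  have hsum := sum_eq_card_mul_sum_reps hR
    (fun u v h hv => ⟨mem_classHull_of_isConj h hv.1, mem_classHull_of_isConj h hv.2⟩)
    (fun u => (fixCount a u : ℚ) * fixCount b u)
    (fun u v h => by rw [fixCount_eq_of_isConj a h, fixCount_eq_of_isConj b h])
    (fun u hu => by
      rw [← hα.stabilizer_eq ha, ← hα.stabilizer_eq hb]
      exact ⟨mem_classHull_of_fixCount_ne_zero a fun h => hu (by simp [h]),
        mem_classHull_of_fixCount_ne_zero b fun h => hu (by simp [h])⟩)
  have hburn : ∑ w : W α, ((fixCount a w : ℚ) * fixCount b w) =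
      (numPoly α a b + numUnivalent α a b) * Fintype.card (W α) := by
    have h := sum_ncard_fixedPairs (α := α) a b
    simp only [ncard_fixedPairs_of_disjoint a b hdisj] at h
    exact_mod_cast h
  have hcard : (Fintype.card (W α) : ℚ) ≠ 0 := by exact_mod_cast Fintype.card_ne_zero
  rw [hburn, mul_comm] at hsum
  rw [eq_sub_iff_add_eq, mul_left_cancel₀ hcard hsum]
  -- Each fixed-point count contributes a factor `cent u`; the class size cancels one of the two.
  refine Finset.sum_congr rfl fun u _ => ?_
  rw [fixCount_eq, fixCount_eq, hα.stabilizer_eq ha, hα.stabilizer_eq hb, div_mul_div_comm,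
    div_div, mul_comm (_ * _) (cent u), mul_div_mul_left _ _ (cent_ne_zero u)]

theorem numPoly_self {n : ℕ} {α : Fin n → E n} (hα : IsSimpleSystem α) {I : Set (Fin n)}
    {a : E n} (ha : a ∈ facet α I) {R R' : Finset (W α)}
    (hR : IsClassReps R (classHull (parabolic α I : Set (W α))))
    (hR' : IsClassReps R' (classHull (sqrtSet (parabolic α I)))) :
    (numPoly α a a : ℚ) = (1 / 2 : ℚ) *
      ((∑ u ∈ R, cent u / centIn (parabolic α I) u ^ 2) +
        ∑ w ∈ R', cent (w ^ 2) / (centIn (parabolic α I) (w ^ 2) * cent w))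
      - 1 - numUnivalent α a a := by
  have := hα.finite
  have := Fintype.ofFinite (W α)
  have hst := hα.stabilizer_eq ha
  have hsum := sum_eq_card_mul_sum_reps hR (fun u v => mem_classHull_of_isConj)
    (fun u => (fixCount a u : ℚ) ^ 2) (fun u v h => by rw [fixCount_eq_of_isConj a h])
    (fun u hu => by
      rw [← hst]
      exact mem_classHull_of_fixCount_ne_zero a fun h => hu (by simp [h]))
  have hsum' := sum_eq_card_mul_sum_reps hR' (fun u v => mem_classHull_of_isConj)
    (fun u => (fixCount a (u ^ 2) : ℚ))
    (fun u v h => by rw [fixCount_eq_of_isConj a (isConj_sq h)])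
    (fun u hu => by
      refine mem_classHull_sqrtSet ?_
      rw [← hst]
      exact mem_classHull_of_fixCount_ne_zero a fun h => hu (by simp [h]))
  -- The summand 2|W| is twice the total of the fixed-point counts.
  have hburn : 2 * ((numPoly α a a + numUnivalent α a a : ℚ) * Fintype.card (W α)) +
      2 * Fintype.card (W α) =
      (∑ w : W α, (fixCount a w : ℚ) ^ 2) + ∑ w : W α, (fixCount a (w ^ 2) : ℚ) := by
    have h := Finset.sum_congr (rfl : (Finset.univ : Finset (W α)) = _)
      fun w _ => two_mul_ncard_fixedPairs a w
    rw [Finset.sum_add_distrib, Finset.sum_add_distrib, ← Finset.mul_sum, ← Finset.mul_sum,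
      sum_ncard_fixedPairs, fixCount_sum] at h
    exact_mod_cast h
  have hcard : (Fintype.card (W α) : ℚ) ≠ 0 := by exact_mod_cast Fintype.card_ne_zero
  have h1 : ∀ u : W α, (fixCount a u : ℚ) ^ 2 / cent u =
      cent u / centIn (parabolic α I) u ^ 2 := fun u => by
    rw [fixCount_eq, hst, div_pow, div_div, pow_two (cent u), mul_comm (_ ^ 2) (cent u),
      mul_div_mul_left _ _ (cent_ne_zero u)]
  have h2 : ∀ u : W α, (fixCount a (u ^ 2) : ℚ) / cent u =
      cent (u ^ 2) / (centIn (parabolic α I) (u ^ 2) * cent u) := fun u => by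
    rw [fixCount_eq, hst, div_div]
  simp only [h1] at hsum
  simp only [h2] at hsum'
  rw [hsum, hsum'] at hburn
  refine mul_left_cancel₀ hcard ?_
  linarith

end Polypolyhedra

theorem mainTheorem1 {n : ℕ} (α : Fin n → Polypolyhedra.E n)
    (hα : Polypolyhedra.IsSimpleSystem α)
    (p : Set (Fin n) → Polypolyhedra.E n)
    (hp : ∀ K : Set (Fin n), p K ∈ Polypolyhedra.facet α K) :
    (∀ I J : Set (Fin n), I ≠ J →
      ∀ R : Finset (Polypolyhedra.W α),
        Polypolyhedra.IsClassReps R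
          (Polypolyhedra.classHull (Polypolyhedra.parabolic α I : Set (Polypolyhedra.W α)) ∩
            Polypolyhedra.classHull (Polypolyhedra.parabolic α J : Set (Polypolyhedra.W α))) →
        (Polypolyhedra.numPoly α (p I) (p J) : ℚ) =
          (∑ u ∈ R, Polypolyhedra.cent u /
            (Polypolyhedra.centIn (Polypolyhedra.parabolic α I) u *
              Polypolyhedra.centIn (Polypolyhedra.parabolic α J) u))
          - Polypolyhedra.numUnivalent α (p I) (p J)) ∧
    (∀ I : Set (Fin n),
      ∀ R R' : Finset (Polypolyhedra.W α),
        Polypolyhedra.IsClassReps R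
          (Polypolyhedra.classHull (Polypolyhedra.parabolic α I : Set (Polypolyhedra.W α))) →
        Polypolyhedra.IsClassReps R'
          (Polypolyhedra.classHull
            (Polypolyhedra.sqrtSet (Polypolyhedra.parabolic α I))) →
        (Polypolyhedra.numPoly α (p I) (p I) : ℚ) =
          (1 / 2 : ℚ) *
            ((∑ u ∈ R, Polypolyhedra.cent u /
                Polypolyhedra.centIn (Polypolyhedra.parabolic α I) u ^ 2) +
              ∑ w ∈ R', Polypolyhedra.cent (w ^ 2) /
                (Polypolyhedra.centIn (Polypolyhedra.parabolic α I) (w ^ 2) *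
                  Polypolyhedra.cent w))
          - 1 - Polypolyhedra.numUnivalent α (p I) (p I)) := by
  exact ⟨fun I J hIJ R hR => Polypolyhedra.numPoly_of_ne hα (hp I) (hp J) hIJ hR,
    fun I R R' hR hR' => Polypolyhedra.numPoly_self hα (hp I) hR hR'⟩
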